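/- Let $\mathbf{R}^3_1$ be Lorentz–Minkowski 3-space with product $a\cdot b=a_1b_1+a_2b_2-a_3b_3$. For a smooth map $f:U\to\mathbf{R}^3_1$ on a domain (non-empty connected open set) $U$ of the $uv$-plane put $$P=\begin{pmatrix} f_u\cdot f_u & f_u\cdot f_v\\ f_v\cdot f_u & f_v\cdot f_v\end{pmatrix},\qquad Q=\begin{pmatrix} f_{uu}\cdot\tilde\nu & f_{uv}\cdot\tilde\nu\\ f_{vu}\cdot\tilde\nu & f_{vv}\cdot\tilde\nu\end{pmatrix},\qquad \tilde\nu=\mathrm{diag}(1,1,-1)\,(f_u\times f_v),$$ where $\times$ is the Euclidean vector product, and let $B_f=\det P$ and $A_f=\mathrm{trace}(\tilde P Q)$, where $\tilde P$ is the cofactor matrix of $P$. Call $f$ a ZMC-map if it is an immersion on an open dense subset of $U$ and $A_f\equiv 0$ on $U$. A ZMC-map is of maximal type if $B_f\ge 0$ on $U$ and $B_f\not\equiv 0$, and of mixed type if $B_f$ takes both positive and negative values on $U$. It is embedded if it is an immersion on all of $U$ and a homeomorphism onto its image. A point $p\in U$ is a null point if $B_f(p)=0$. The map $f$ contains an entire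 null line if there are an open interval $I\subseteq\mathbf{R}$ and a smooth curve $\gamma:I\to U$ such that $\gamma(I)$ consists only of null points and $f(\gamma(I))$ is a complete light-like line $\{a+sv: s\in\mathbf{R}\}$, where $v\neq 0$ and $v\cdot v=0$. **Theorem.** (1) There exists an embedded ZMC-map $f:U\to\mathbf{R}^3_1$ of maximal type, defined on a domain $U$ of the plane, that contains an entire null line. (2) There exists an embedded ZMC-map $f:U\to\mathbf{R}^3_1$ of mixed type, defined on a domain $U$ of the plane, that contains an entire null line. -/

import Mathlib

open Set
open scoped ContDiff Matrix

noncomputable section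

namespace LorentzMinkowski

/-- The underlying vector space of Lorentz-Minkowski 3-space, with coordinates `(x, y, t)`. -/
abbrev R31 : Type := Fin 3 → ℝ

/-- The Lorentzian product of signature `(+, +, -)`. -/
def lorentz (a b : R31) : ℝ := a 0 * b 0 + a 1 * b 1 - a 2 * b 2

/-- The partial derivative in the first variable `u`. -/
def du (f : ℝ × ℝ → R31) (p : ℝ × ℝ) : R31 := fderiv ℝ f p (1, 0)

/-- The partial derivative in the second variable `v`. -/
def dv (f : ℝ × ℝ → R31) (p : ℝ × ℝ) : R31 := fderiv ℝ f p (0, 1)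

/-- The matrix `P` of the first fundamental form (the metric induced by `f`). -/
def firstForm (f : ℝ × ℝ → R31) (p : ℝ × ℝ) : Matrix (Fin 2) (Fin 2) ℝ :=
  !![lorentz (du f p) (du f p), lorentz (du f p) (dv f p);
     lorentz (dv f p) (du f p), lorentz (dv f p) (dv f p)]

/-- The function `B_f = det P`. -/
def B (f : ℝ × ℝ → R31) (p : ℝ × ℝ) : ℝ := (firstForm f p).det

/-- The Lorentzian normal field `diag(1, 1, -1) (f_u × f_v)`, where `×` is the Euclidean vector
product. -/
def normal (f : ℝ × ℝ → R31) (p : ℝ × ℝ) : R31 :=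
  Matrix.diagonal ![1, 1, -1] *ᵥ crossProduct (du f p) (dv f p)

/-- The matrix `Q` of the second fundamental form with respect to the (unnormalized) normal
field. -/
def secondForm (f : ℝ × ℝ → R31) (p : ℝ × ℝ) : Matrix (Fin 2) (Fin 2) ℝ :=
  !![lorentz (du (du f) p) (normal f p), lorentz (dv (du f) p) (normal f p);
     lorentz (du (dv f) p) (normal f p), lorentz (dv (dv f) p) (normal f p)]

/-- The function `A_f = trace (P̃ Q)`, where `P̃` is the cofactor matrix of `P`
(the transpose of Mathlib's `Matrix.adjugate`; as `P` is symmetric the two agree). -/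
def A (f : ℝ × ℝ → R31) (p : ℝ × ℝ) : ℝ :=
  ((firstForm f p).adjugateᵀ * secondForm f p).trace

/-- A domain in the plane: a non-empty connected open set. -/
def IsPlaneDomain (U : Set (ℝ × ℝ)) : Prop := IsOpen U ∧ IsConnected U

/-- `f` is a ZMC-map (zero mean curvature map) on the domain `U`: it is smooth on `U`, it is an
immersion on an open dense subset of `U`, and `A_f` vanishes identically on `U`. -/
structure IsZMCMap (U : Set (ℝ × ℝ)) (f : ℝ × ℝ → R31) : Prop where
  smooth : ContDiffOn ℝ ∞ f U
  immersion_dense : ∃ V : Set (ℝ × ℝ), V ⊆ U ∧ IsOpen V ∧ U ⊆ closure V ∧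
    ∀ p ∈ V, Function.Injective (fderiv ℝ f p)
  A_eq_zero : ∀ p ∈ U, A f p = 0

/-- `f` is an embedding of `U`: an immersion at every point of `U` and a homeomorphism from `U`
onto its image. -/
def IsEmbedded (U : Set (ℝ × ℝ)) (f : ℝ × ℝ → R31) : Prop :=
  (∀ p ∈ U, Function.Injective (fderiv ℝ f p)) ∧ Topology.IsEmbedding (fun p : U => f p)

/-- Maximal type: `B_f ≥ 0` on `U`, but `B_f` does not vanish identically on `U`. -/
def IsMaximalType (U : Set (ℝ × ℝ)) (f : ℝ × ℝ → R31) : Prop :=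
  (∀ p ∈ U, 0 ≤ B f p) ∧ ∃ p ∈ U, B f p ≠ 0

/-- Mixed type: `B_f` changes its sign on `U`. -/
def IsMixedType (U : Set (ℝ × ℝ)) (f : ℝ × ℝ → R31) : Prop :=
  (∃ p ∈ U, 0 < B f p) ∧ ∃ q ∈ U, B f q < 0

/-- A space-like point of `f`. -/
def IsSpacelikePt (f : ℝ × ℝ → R31) (p : ℝ × ℝ) : Prop := 0 < B f p

/-- A time-like point of `f`. -/
def IsTimelikePt (f : ℝ × ℝ → R31) (p : ℝ × ℝ) : Prop := B f p < 0

/-- A null (light-like) point of `f`: neither space-like nor time-like. -/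
def IsNullPt (f : ℝ × ℝ → R31) (p : ℝ × ℝ) : Prop :=
  ¬ IsSpacelikePt f p ∧ ¬ IsTimelikePt f p

/-- A complete light-like line: the full affine line in the direction of a non-zero vector `v`
with `v · v = 0`. -/
def IsLightlikeLine (L : Set R31) : Prop :=
  ∃ a v : R31, v ≠ 0 ∧ lorentz v v = 0 ∧ L = range fun s : ℝ => a + s • v

/-- `f` contains an entire null line: there are an open interval `I` and a smooth curve
`γ : I → U` consisting only of null points of `f` such that `f ∘ γ (I)` coincides with a complete
light-like line. -/
def ContainsEntireNullLine (U : Set (ℝ × ℝ)) (f : ℝ × ℝ → R31) : Prop :=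
  ∃ (I : Set ℝ) (γ : ℝ → ℝ × ℝ), IsOpen I ∧ I.OrdConnected ∧ ContDiffOn ℝ ∞ γ I ∧
    MapsTo γ I U ∧ (∀ s ∈ I, IsNullPt f (γ s)) ∧ IsLightlikeLine ((f ∘ γ) '' I)

end LorentzMinkowski

end

namespace LorentzMinkowski

/-! Both surfaces are explicit and rational in the null coordinates z = (y + t)/2, w = (y - t)/2,
where a vector has Lorentzian square x² + 4zw and the z-axis is light-like. Each map sends the
v-axis onto the z-axis with z = v. Both have a scaling symmetry. Replacing (u, v) by (λu, v/λ) in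
`maxMap` multiplies (x, z, w) by (λ, λ⁻¹, λ³). Replacing it by (λ²u, v/λ) in `mixedMap` multiplies
(x, z, w) by (λ², λ⁻¹, λ⁵). Both are Lorentzian similarities. So up to weights everything depends on
r = uv, respectively r = uv², and the domain is a bound on |r|: it narrows as |v| grows, yet
contains the whole v-axis. Given `A_ofNull` and `B_ofNull`, A_f = 0 is a rational identity, and B_f
is u⁴, respectively -u³, times a nonnegative factor; this decides the type. The bound on |r| makes
(u, v) ↦ (x, z) regular, which gives the immersion. Solving a quadratic in r inverts that map
continuously, which gives the embedding. -/

/-! ### Calculus of partial derivatives -/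

/-- The scalar function `g` is differentiable at `p` with partial derivatives `a` and `b`. -/
def HasGrad (g : ℝ × ℝ → ℝ) (a b : ℝ) (p : ℝ × ℝ) : Prop :=
  HasFDerivAt g (a • ContinuousLinearMap.fst ℝ ℝ ℝ + b • ContinuousLinearMap.snd ℝ ℝ ℝ) p

namespace HasGrad

variable {g h : ℝ × ℝ → ℝ} {a b c d : ℝ} {p : ℝ × ℝ}

theorem congr (hg : HasGrad g a b p) (hac : a = c) (hbd : b = d) : HasGrad g c d p :=
  hac ▸ hbd ▸ hg

theorem const (k : ℝ) (p : ℝ × ℝ) : HasGrad (fun _ => k) 0 0 p := by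
  simpa [HasGrad] using hasFDerivAt_const k p

theorem fst (p : ℝ × ℝ) : HasGrad (fun q => q.1) 1 0 p := by
  simpa [HasGrad] using hasFDerivAt_fst (𝕜 := ℝ) (p := p)

theorem snd (p : ℝ × ℝ) : HasGrad (fun q => q.2) 0 1 p := by
  simpa [HasGrad] using hasFDerivAt_snd (𝕜 := ℝ) (p := p)

theorem add (hg : HasGrad g a b p) (hh : HasGrad h c d p) :
    HasGrad (fun q => g q + h q) (a + c) (b + d) p := by
  refine (HasFDerivAt.add hg hh).congr_fderiv ?_
  ext <;> simp

theorem sub (hg : HasGrad g a b p) (hh : HasGrad h c d p) :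
    HasGrad (fun q => g q - h q) (a - c) (b - d) p := by
  refine (HasFDerivAt.sub hg hh).congr_fderiv ?_
  ext <;> simp

theorem neg (hg : HasGrad g a b p) : HasGrad (fun q => -g q) (-a) (-b) p := by
  refine (HasFDerivAt.neg hg).congr_fderiv ?_
  ext <;> simp

theorem mul (hg : HasGrad g a b p) (hh : HasGrad h c d p) :
    HasGrad (fun q => g q * h q) (a * h p + g p * c) (b * h p + g p * d) p := by
  refine (HasFDerivAt.mul hg hh).congr_fderiv ?_
  ext <;> simp <;> ring

theorem pow (hg : HasGrad g a b p) (n : ℕ) :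
    HasGrad (fun q => g q ^ n) (n * g p ^ (n - 1) * a) (n * g p ^ (n - 1) * b) p := by
  refine (HasFDerivAt.pow hg n).congr_fderiv ?_
  ext <;> simp

theorem inv (hg : HasGrad g a b p) (h0 : g p ≠ 0) :
    HasGrad (fun q => (g q)⁻¹) (-a / g p ^ 2) (-b / g p ^ 2) p := by
  refine ((hasDerivAt_inv h0).comp_hasFDerivAt p hg).congr_fderiv ?_
  ext <;> simp <;> ring

theorem div (hg : HasGrad g a b p) (hh : HasGrad h c d p) (h0 : h p ≠ 0) :
    HasGrad (fun q => g q / h q) ((a * h p - g p * c) / h p ^ 2)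
      ((b * h p - g p * d) / h p ^ 2) p := by
  simp only [div_eq_mul_inv (g _)]
  refine (hg.mul (hh.inv h0)).congr ?_ ?_ <;> field_simp <;> ring

end HasGrad

/-! ### Surfaces in null coordinates -/

/-- The vector with coordinates `(a, b, c)` in the frame `(1, 0, 0)`, `(0, 1, 1)`, `(0, 1, -1)`,
whose last two vectors are null. -/
def ofNull (a b c : ℝ) : R31 := ![a, b + c, b - c]

theorem fderiv_ofNull {x z w : ℝ × ℝ → ℝ} {xu xv zu zv wu wv : ℝ} {p : ℝ × ℝ}
    (hx : HasGrad x xu xv p) (hz : HasGrad z zu zv p) (hw : HasGrad w wu wv p) (q : ℝ × ℝ) :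
    fderiv ℝ (fun q => ofNull (x q) (z q) (w q)) p q =
      ofNull (xu * q.1 + xv * q.2) (zu * q.1 + zv * q.2) (wu * q.1 + wv * q.2) := by
  have h : HasFDerivAt (fun q => ofNull (x q) (z q) (w q))
      (ContinuousLinearMap.pi ![xu • ContinuousLinearMap.fst ℝ ℝ ℝ
          + xv • ContinuousLinearMap.snd ℝ ℝ ℝ,
        (zu + wu) • ContinuousLinearMap.fst ℝ ℝ ℝ + (zv + wv) • ContinuousLinearMap.snd ℝ ℝ ℝ,
        (zu - wu) • ContinuousLinearMap.fst ℝ ℝ ℝ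
          + (zv - wv) • ContinuousLinearMap.snd ℝ ℝ ℝ]) p := by
    rw [hasFDerivAt_pi']
    intro i
    fin_cases i
    · exact hx.congr_fderiv (by ext <;> simp)
    · exact (hz.add hw).congr_fderiv (by ext <;> simp)
    · exact (hz.sub hw).congr_fderiv (by ext <;> simp)
  rw [h.fderiv]
  ext i
  fin_cases i <;> simp [ofNull] <;> ring

section

variable {x z w : ℝ × ℝ → ℝ} {xu xv zu zv wu wv : ℝ} {p : ℝ × ℝ}

theorem du_ofNull (hx : HasGrad x (xu) (xv) p) (hz : HasGrad z (zu) (zv) p)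
    (hw : HasGrad w (wu) (wv) p) :
    du (fun q => ofNull (x q) (z q) (w q)) p = ofNull (xu) (zu) (wu) := by
  simp [du, fderiv_ofNull hx hz hw]

theorem dv_ofNull (hx : HasGrad x (xu) (xv) p) (hz : HasGrad z (zu) (zv) p)
    (hw : HasGrad w (wu) (wv) p) :
    dv (fun q => ofNull (x q) (z q) (w q)) p = ofNull (xv) (zv) (wv) := by
  simp [dv, fderiv_ofNull hx hz hw]

/-- The projection to (x, z) is already regular, so w plays no role. -/
theorem injective_fderiv_ofNull (hx : HasGrad x (xu) (xv) p) (hz : HasGrad z (zu) (zv) p)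
    (hw : HasGrad w (wu) (wv) p) (hdet : xu * zv - xv * zu ≠ 0) :
    Function.Injective (fderiv ℝ (fun q => ofNull (x q) (z q) (w q)) p) := by
  rw [injective_iff_map_eq_zero]
  rintro ⟨a, b⟩ hq
  rw [fderiv_ofNull hx hz hw] at hq
  have h0 : xu * a + xv * b = 0 := by simpa [ofNull] using congrFun hq 0
  have h1 := congrFun hq 1
  have h2 := congrFun hq 2
  simp only [ofNull, Matrix.cons_val, Pi.zero_apply] at h1 h2
  -- Cramer's rule; w cancels in y + t = 2z, that is, in `h1 + h2`.
  have ha : (xu * zv - xv * zu) * a = 0 := by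
    linear_combination zv * h0 - xv * (h1 + h2) / 2
  have hb : (xu * zv - xv * zu) * b = 0 := by
    linear_combination xu * (h1 + h2) / 2 - zu * h0
  simp_all

theorem B_ofNull (hx : HasGrad x (xu) (xv) p) (hz : HasGrad z (zu) (zv) p)
    (hw : HasGrad w (wu) (wv) p) :
    B (fun q => ofNull (x q) (z q) (w q)) p =
      (xu ^ 2 + 4 * zu * wu) * (xv ^ 2 + 4 * zv * wv)
        - (xu * xv + 2 * (zu * wv + zv * wu)) ^ 2 := by
  simp only [B, firstForm, du_ofNull hx hz hw, dv_ofNull hx hz hw, Matrix.det_fin_two_of]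
  simp only [lorentz, ofNull, Matrix.cons_val]
  ring

end

/-- `x` has first partial derivatives `xu`, `xv` and second partial derivatives `xuu`, `xuv`,
`xvv` on `U`. -/
structure HasPartials (U : Set (ℝ × ℝ)) (x xu xv xuu xuv xvv : ℝ × ℝ → ℝ) : Prop where
  grad : ∀ p ∈ U, HasGrad x (xu p) (xv p) p
  grad_u : ∀ p ∈ U, HasGrad xu (xuu p) (xuv p) p
  grad_v : ∀ p ∈ U, HasGrad xv (xuv p) (xvv p) p

section

variable {U : Set (ℝ × ℝ)} {x xu xv xuu xuv xvv z zu zv zuu zuv zvv w wu wv wuu wuv wvv :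
  ℝ × ℝ → ℝ} {p : ℝ × ℝ}

/-- The two sign changes of t cancel, leaving the Euclidean determinant of the vector with f_u and
f_v; the null frame contributes its determinant -2. -/
theorem lorentz_normal (f : ℝ × ℝ → R31) (a a₁ a₂ b b₁ b₂ c c₁ c₂ : ℝ)
    (hu : du f p = ofNull a₁ b₁ c₁) (hv : dv f p = ofNull a₂ b₂ c₂) :
    lorentz (ofNull a b c) (normal f p) =
      2 * (a * (b₂ * c₁ - b₁ * c₂) + b * (a₁ * c₂ - a₂ * c₁) + c * (a₂ * b₁ - a₁ * b₂)) := by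
  simp only [normal, hu, hv, lorentz, ofNull, cross_apply, Matrix.mulVec_diagonal, Matrix.cons_val]
  ring

theorem A_ofNull (hU : IsOpen U) (hx : HasPartials U x xu xv xuu xuv xvv)
    (hz : HasPartials U z zu zv zuu zuv zvv) (hw : HasPartials U w wu wv wuu wuv wvv)
    (hp : p ∈ U) :
    A (fun q => ofNull (x q) (z q) (w q)) p =
      2 * ((xv p ^ 2 + 4 * zv p * wv p) *
          (xuu p * (zv p * wu p - zu p * wv p) + zuu p * (xu p * wv p - xv p * wu p)
            + wuu p * (xv p * zu p - xu p * zv p))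
        - 2 * (xu p * xv p + 2 * (zu p * wv p + zv p * wu p)) *
          (xuv p * (zv p * wu p - zu p * wv p) + zuv p * (xu p * wv p - xv p * wu p)
            + wuv p * (xv p * zu p - xu p * zv p))
        + (xu p ^ 2 + 4 * zu p * wu p) *
          (xvv p * (zv p * wu p - zu p * wv p) + zvv p * (xu p * wv p - xv p * wu p)
            + wvv p * (xv p * zu p - xu p * zv p))) := by
  -- Differentiating again requires the first partials on a neighbourhood of p, hence the openness
  -- of U.
  have hu : du (fun q => ofNull (x q) (z q) (w q)) =ᶠ[nhds p]
      fun q => ofNull (xu q) (zu q) (wu q) := by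
    filter_upwards [hU.mem_nhds hp] with q hq
    exact du_ofNull (hx.grad q hq) (hz.grad q hq) (hw.grad q hq)
  have hv : dv (fun q => ofNull (x q) (z q) (w q)) =ᶠ[nhds p]
      fun q => ofNull (xv q) (zv q) (wv q) := by
    filter_upwards [hU.mem_nhds hp] with q hq
    exact dv_ofNull (hx.grad q hq) (hz.grad q hq) (hw.grad q hq)
  have huu : du (du fun q => ofNull (x q) (z q) (w q)) p = ofNull (xuu p) (zuu p) (wuu p) := by
    rw [du, hu.fderiv_eq]
    exact du_ofNull (hx.grad_u p hp) (hz.grad_u p hp) (hw.grad_u p hp)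
  have huv : dv (du fun q => ofNull (x q) (z q) (w q)) p = ofNull (xuv p) (zuv p) (wuv p) := by
    rw [dv, hu.fderiv_eq]
    exact dv_ofNull (hx.grad_u p hp) (hz.grad_u p hp) (hw.grad_u p hp)
  have hvu : du (dv fun q => ofNull (x q) (z q) (w q)) p = ofNull (xuv p) (zuv p) (wuv p) := by
    rw [du, hv.fderiv_eq]
    exact du_ofNull (hx.grad_v p hp) (hz.grad_v p hp) (hw.grad_v p hp)
  have hvv : dv (dv fun q => ofNull (x q) (z q) (w q)) p = ofNull (xvv p) (zvv p) (wvv p) := by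
    rw [dv, hv.fderiv_eq]
    exact dv_ofNull (hx.grad_v p hp) (hz.grad_v p hp) (hw.grad_v p hp)
  simp only [A, firstForm, secondForm, huu, huv, hvu, hvv,
    lorentz_normal _ _ _ _ _ _ _ _ _ _ hu.self_of_nhds hv.self_of_nhds, hu.self_of_nhds,
    hv.self_of_nhds, Matrix.adjugate_fin_two_of, Matrix.trace_fin_two, Matrix.mul_apply,
    Fin.sum_univ_two, Matrix.transpose_apply]
  simp [lorentz, ofNull]
  ring

theorem contDiffOn_ofNull (hx : ContDiffOn ℝ ∞ x U) (hz : ContDiffOn ℝ ∞ z U)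
    (hw : ContDiffOn ℝ ∞ w U) : ContDiffOn ℝ ∞ (fun q => ofNull (x q) (z q) (w q)) U := by
  rw [contDiffOn_pi]
  intro i
  fin_cases i
  · exact hx
  · exact hz.add hw
  · exact hz.sub hw

end

/-! ### Criteria for the required properties -/

theorem IsZMCMap.of_immersion {U : Set (ℝ × ℝ)} {f : ℝ × ℝ → R31} (hU : IsOpen U)
    (hf : ContDiffOn ℝ ∞ f U) (hi : ∀ p ∈ U, Function.Injective (fderiv ℝ f p))
    (hA : ∀ p ∈ U, A f p = 0) : IsZMCMap U f :=
  ⟨hf, ⟨U, subset_rfl, hU, subset_closure, hi⟩, hA⟩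

/-- A continuous map with a continuous left inverse is a topological embedding. -/
theorem isEmbedding_of_leftInvOn {U : Set (ℝ × ℝ)} {f : ℝ × ℝ → R31} {g : R31 → ℝ × ℝ}
    (hf : ContinuousOn f U) (hg : Continuous g) (hgf : LeftInvOn g f U) :
    Topology.IsEmbedding fun p : U => f p := by
  refine Topology.IsEmbedding.of_comp hf.domRestrict hg ?_
  convert Topology.IsEmbedding.subtypeVal (p := (· ∈ U)) using 1
  ext1 p
  exact hgf p.2

/-- If `f` maps the `v`-axis onto `{(0, s, s)}` by `v ↦ (0, v, v)` and the axis consists of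
points with `B_f = 0`, then `f` contains an entire null line. -/
theorem containsEntireNullLine_of_axis {U : Set (ℝ × ℝ)} {f : ℝ × ℝ → R31}
    (hU : ∀ s : ℝ, ((0 : ℝ), s) ∈ U) (hB : ∀ s : ℝ, B f (0, s) = 0)
    (hf : ∀ s : ℝ, f (0, s) = ofNull 0 s 0) : ContainsEntireNullLine U f := by
  refine ⟨univ, fun s => (0, s), isOpen_univ, ordConnected_univ,
    (contDiff_const.prodMk contDiff_id).contDiffOn, fun s _ => hU s, fun s _ => ?_,
    0, ofNull 0 1 0, ?_, ?_, ?_⟩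
  · simp [IsNullPt, IsSpacelikePt, IsTimelikePt, hB]
  · intro h
    simpa [ofNull] using congrFun h 1
  · simp [lorentz, ofNull]
  · rw [image_univ]
    congr 1
    ext s i
    fin_cases i <;> simp [hf, ofNull]

theorem isPlaneDomain_of_starConvex {U : Set (ℝ × ℝ)} (hU : IsOpen U) (h0 : 0 ∈ U)
    (h : ∀ p ∈ U, ∀ t ∈ Icc (0 : ℝ) 1, t • p ∈ U) : IsPlaneDomain U := by
  refine ⟨hU, ?_⟩
  have hs : StarConvex ℝ 0 U := by
    rw [starConvex_zero_iff]
    intro p hp t ht0 ht1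
    exact h p hp t ⟨ht0, ht1⟩
  exact (hs.isPathConnected h0).isConnected

/-! ### The maximal example, r = uv -/

/-- The domain `|u v| < 1` of the maximal example. -/
def maxDomain : Set (ℝ × ℝ) := {p | |p.1 * p.2| < 1}

/-- A rationally parametrized surface of maximal type containing an entire null line. -/
noncomputable def maxMap (p : ℝ × ℝ) : R31 :=
  ofNull (2 * p.1) (p.2 / (1 + p.1 ^ 2 * p.2 ^ 2)) (p.1 ^ 4 * p.2 - p.1 ^ 6 * p.2 ^ 3 / 3)

theorem maxMap_hasPartials_x : HasPartials maxDomain (fun p => 2 * p.1) (fun _ => 2) (fun _ => 0)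
    (fun _ => 0) (fun _ => 0) (fun _ => 0) where
  grad p _ := ((HasGrad.const 2 p).mul (.fst p)).congr (by ring) (by ring)
  grad_u p _ := .const 2 p
  grad_v p _ := .const 0 p

theorem maxMap_denom_pos (p : ℝ × ℝ) : 0 < 1 + p.1 ^ 2 * p.2 ^ 2 := by positivity

theorem maxMap_hasGrad_denom (p : ℝ × ℝ) : HasGrad (fun p => 1 + p.1 ^ 2 * p.2 ^ 2)
    (2 * p.1 * p.2 ^ 2) (2 * p.1 ^ 2 * p.2) p :=
  ((HasGrad.const 1 p).add (((HasGrad.fst p).pow 2).mul ((HasGrad.snd p).pow 2))).congr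
    (by norm_num) (by norm_num; ring)

theorem maxMap_hasPartials_z : HasPartials maxDomain (fun p => p.2 / (1 + p.1 ^ 2 * p.2 ^ 2))
    (fun p => -2 * p.1 * p.2 ^ 3 / (1 + p.1 ^ 2 * p.2 ^ 2) ^ 2)
    (fun p => (1 - p.1 ^ 2 * p.2 ^ 2) / (1 + p.1 ^ 2 * p.2 ^ 2) ^ 2)
    (fun p => (6 * p.1 ^ 2 * p.2 ^ 5 - 2 * p.2 ^ 3) / (1 + p.1 ^ 2 * p.2 ^ 2) ^ 3)
    (fun p => (2 * p.1 ^ 3 * p.2 ^ 4 - 6 * p.1 * p.2 ^ 2) / (1 + p.1 ^ 2 * p.2 ^ 2) ^ 3)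
    (fun p => (2 * p.1 ^ 4 * p.2 ^ 3 - 6 * p.1 ^ 2 * p.2) / (1 + p.1 ^ 2 * p.2 ^ 2) ^ 3) where
  grad p _ := by
    have h := (maxMap_denom_pos p).ne'
    refine ((HasGrad.snd p).div (maxMap_hasGrad_denom p) h).congr ?_ ?_ <;> field_simp <;> ring
  grad_u p _ := by
    have h := (maxMap_denom_pos p).ne'
    refine ((((HasGrad.const (-2) p).mul (.fst p)).mul ((HasGrad.snd p).pow 3)).div
      ((maxMap_hasGrad_denom p).pow 2) (pow_ne_zero 2 h)).congr ?_ ?_ <;>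
      norm_num <;> field_simp <;> ring
  grad_v p _ := by
    have h := (maxMap_denom_pos p).ne'
    refine (((HasGrad.const 1 p).sub (((HasGrad.fst p).pow 2).mul ((HasGrad.snd p).pow 2))).div
      ((maxMap_hasGrad_denom p).pow 2) (pow_ne_zero 2 h)).congr ?_ ?_ <;>
      norm_num <;> field_simp <;> ring

theorem maxMap_hasPartials_w : HasPartials maxDomain
    (fun p => p.1 ^ 4 * p.2 - p.1 ^ 6 * p.2 ^ 3 / 3)
    (fun p => 4 * p.1 ^ 3 * p.2 - 2 * p.1 ^ 5 * p.2 ^ 3)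
    (fun p => p.1 ^ 4 - p.1 ^ 6 * p.2 ^ 2)
    (fun p => 12 * p.1 ^ 2 * p.2 - 10 * p.1 ^ 4 * p.2 ^ 3)
    (fun p => 4 * p.1 ^ 3 - 6 * p.1 ^ 5 * p.2 ^ 2)
    (fun p => -2 * p.1 ^ 6 * p.2) where
  grad p _ := by
    refine ((((HasGrad.fst p).pow 4).mul (.snd p)).sub ((((HasGrad.fst p).pow 6).mul
      ((HasGrad.snd p).pow 3)).div (.const 3 p) three_ne_zero)).congr ?_ ?_ <;> norm_num <;> ring
  grad_u p _ := by
    refine ((((HasGrad.const 4 p).mul ((HasGrad.fst p).pow 3)).mul (.snd p)).sub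
      (((HasGrad.const 2 p).mul ((HasGrad.fst p).pow 5)).mul ((HasGrad.snd p).pow 3))).congr
      ?_ ?_ <;> norm_num <;> ring
  grad_v p _ := by
    refine (((HasGrad.fst p).pow 4).sub (((HasGrad.fst p).pow 6).mul
      ((HasGrad.snd p).pow 2))).congr ?_ ?_ <;> norm_num <;> ring

theorem isOpen_maxDomain : IsOpen maxDomain :=
  isOpen_lt (by fun_prop) continuous_const

theorem isPlaneDomain_maxDomain : IsPlaneDomain maxDomain := by
  refine isPlaneDomain_of_starConvex isOpen_maxDomain (by simp [maxDomain]) ?_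
  rintro p hp t ⟨ht0, ht1⟩
  simp only [maxDomain, mem_ofPred_eq, Prod.smul_fst, Prod.smul_snd, smul_eq_mul] at hp ⊢
  have : t * p.1 * (t * p.2) = t ^ 2 * (p.1 * p.2) := by ring
  rw [this, abs_mul, abs_of_nonneg (by positivity)]
  exact (mul_le_of_le_one_left (abs_nonneg _) (pow_le_one₀ ht0 ht1)).trans_lt hp

theorem B_maxMap {p : ℝ × ℝ} (hp : p ∈ maxDomain) :
    B maxMap p = 16 * p.1 ^ 4 * (1 - p.1 ^ 2 * p.2 ^ 2) ^ 4 / (1 + p.1 ^ 2 * p.2 ^ 2) ^ 4 := by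
  refine (B_ofNull (maxMap_hasPartials_x.grad p hp) (maxMap_hasPartials_z.grad p hp)
    (maxMap_hasPartials_w.grad p hp)).trans ?_
  have h := (maxMap_denom_pos p).ne'
  field_simp
  ring

theorem A_maxMap {p : ℝ × ℝ} (hp : p ∈ maxDomain) : A maxMap p = 0 := by
  refine (A_ofNull isOpen_maxDomain maxMap_hasPartials_x maxMap_hasPartials_z
    maxMap_hasPartials_w hp).trans ?_
  have h := (maxMap_denom_pos p).ne'
  field_simp
  ring

/-- Keeps 1 - r² positive: this factor governs both the Jacobian of (x, z) and the branch of the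
square root in the inverse. -/
theorem mul_sq_lt_one_of_mem_maxDomain {p : ℝ × ℝ} (hp : p ∈ maxDomain) :
    p.1 ^ 2 * p.2 ^ 2 < 1 := by
  rw [← mul_pow]
  exact (sq_lt_one_iff_abs_lt_one _).2 hp

theorem injective_fderiv_maxMap {p : ℝ × ℝ} (hp : p ∈ maxDomain) :
    Function.Injective (fderiv ℝ maxMap p) := by
  refine injective_fderiv_ofNull (maxMap_hasPartials_x.grad p hp)
    (maxMap_hasPartials_z.grad p hp) (maxMap_hasPartials_w.grad p hp) ?_
  have h := maxMap_denom_pos p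
  have h' : 0 < 1 - p.1 ^ 2 * p.2 ^ 2 := sub_pos.2 (mul_sq_lt_one_of_mem_maxDomain hp)
  rw [zero_mul, sub_zero]
  positivity

theorem contDiffOn_maxMap : ContDiffOn ℝ ∞ maxMap maxDomain := by
  refine contDiffOn_ofNull (by fun_prop) (ContDiffOn.div (by fun_prop) (by fun_prop) ?_)
    (by fun_prop)
  exact fun p _ => (maxMap_denom_pos p).ne'

/-- A continuous left inverse of `maxMap`. -/
noncomputable def maxMapInv (q : R31) : ℝ × ℝ :=
  (q 0 / 2, (q 1 + q 2) / (1 + √(1 - 4 * (q 0 * (q 1 + q 2) / 4) ^ 2)))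

/-- Global continuity holds because `√` is 0 on negative numbers, so the denominator is at least 1
everywhere. -/
theorem continuous_maxMapInv : Continuous maxMapInv := by
  unfold maxMapInv
  refine Continuous.prodMk (by fun_prop) (Continuous.div (by fun_prop) (by fun_prop) fun q => ?_)
  positivity

theorem leftInvOn_maxMapInv : LeftInvOn maxMapInv maxMap maxDomain := by
  rintro ⟨u, v⟩ hp
  have h : 0 < 1 + u ^ 2 * v ^ 2 := maxMap_denom_pos (u, v)
  have h' : 0 < 1 - u ^ 2 * v ^ 2 := sub_pos.2 (mul_sq_lt_one_of_mem_maxDomain hp)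
  -- Discriminant of c r² - r + c = 0, where c = uz = r/(1 + r²); the root is the positive one since
  -- |r| < 1.
  have hs : √(1 - 4 * (u * v / (1 + u ^ 2 * v ^ 2)) ^ 2)
      = (1 - u ^ 2 * v ^ 2) / (1 + u ^ 2 * v ^ 2) := by
    rw [Real.sqrt_eq_iff_mul_self_eq_of_pos (by positivity)]
    field_simp
    ring
  have hz : maxMap (u, v) 1 + maxMap (u, v) 2 = 2 * (v / (1 + u ^ 2 * v ^ 2)) := by
    simp only [maxMap, ofNull, Matrix.cons_val]
    ring
  have hx : maxMap (u, v) 0 = 2 * u := rfl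
  have hc : 2 * u * (2 * (v / (1 + u ^ 2 * v ^ 2))) / 4 = u * v / (1 + u ^ 2 * v ^ 2) := by ring
  rw [maxMapInv, hz, hx, hc, hs]
  ext
  · simp
  · simp only
    field_simp
    ring

theorem isEmbedded_maxMap : IsEmbedded maxDomain maxMap :=
  ⟨fun _ hp => injective_fderiv_maxMap hp, isEmbedding_of_leftInvOn contDiffOn_maxMap.continuousOn
    continuous_maxMapInv leftInvOn_maxMapInv⟩

theorem isMaximalType_maxMap : IsMaximalType maxDomain maxMap := by
  refine ⟨fun p hp => ?_, (1, 0), ?_, ?_⟩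
  · rw [B_maxMap hp]
    positivity
  · simp [maxDomain]
  · rw [B_maxMap (by simp [maxDomain])]
    norm_num

theorem containsEntireNullLine_maxMap : ContainsEntireNullLine maxDomain maxMap := by
  have h (s : ℝ) : ((0 : ℝ), s) ∈ maxDomain := by simp [maxDomain]
  refine containsEntireNullLine_of_axis h (fun s => ?_) fun s => ?_
  · simp [B_maxMap (h s)]
  · simp [maxMap]

/-! ### The mixed example, r = uv² -/

/-- The domain `|u v²| < 1/3` of the mixed type example. -/
def mixedDomain : Set (ℝ × ℝ) := {p | |p.1 * p.2 ^ 2| < 1 / 3}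

/-- A rationally parametrized surface of mixed type containing an entire null line. -/
noncomputable def mixedMap (p : ℝ × ℝ) : R31 :=
  ofNull (p.1 + p.1 ^ 2 * p.2 ^ 2) (p.2 / (1 - p.1 * p.2 ^ 2))
    (-(p.1 ^ 3 * p.2 + 2 * p.1 ^ 4 * p.2 ^ 3 + p.1 ^ 5 * p.2 ^ 5 / 5))

theorem mixedMap_hasPartials_x : HasPartials mixedDomain (fun p => p.1 + p.1 ^ 2 * p.2 ^ 2)
    (fun p => 1 + 2 * p.1 * p.2 ^ 2) (fun p => 2 * p.1 ^ 2 * p.2)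
    (fun p => 2 * p.2 ^ 2) (fun p => 4 * p.1 * p.2) (fun p => 2 * p.1 ^ 2) where
  grad p _ := by
    refine ((HasGrad.fst p).add (((HasGrad.fst p).pow 2).mul ((HasGrad.snd p).pow 2))).congr
      ?_ ?_ <;> norm_num <;> ring
  grad_u p _ := by
    refine ((HasGrad.const 1 p).add (((HasGrad.const 2 p).mul (.fst p)).mul
      ((HasGrad.snd p).pow 2))).congr ?_ ?_ <;> norm_num1 <;> ring
  grad_v p _ := by
    refine (((HasGrad.const 2 p).mul ((HasGrad.fst p).pow 2)).mul (.snd p)).congr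
      ?_ ?_ <;> norm_num1 <;> ring

theorem mixedMap_denom_pos {p : ℝ × ℝ} (hp : p ∈ mixedDomain) : 0 < 1 - p.1 * p.2 ^ 2 := by
  have h : p.1 * p.2 ^ 2 < 1 / 3 := (abs_lt.1 hp).2
  linarith

theorem mixedMap_hasGrad_denom (p : ℝ × ℝ) : HasGrad (fun p => 1 - p.1 * p.2 ^ 2)
    (-p.2 ^ 2) (-2 * p.1 * p.2) p :=
  ((HasGrad.const 1 p).sub ((HasGrad.fst p).mul ((HasGrad.snd p).pow 2))).congr
    (by norm_num) (by norm_num; ring)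

theorem mixedMap_hasPartials_z : HasPartials mixedDomain (fun p => p.2 / (1 - p.1 * p.2 ^ 2))
    (fun p => p.2 ^ 3 / (1 - p.1 * p.2 ^ 2) ^ 2)
    (fun p => (1 + p.1 * p.2 ^ 2) / (1 - p.1 * p.2 ^ 2) ^ 2)
    (fun p => 2 * p.2 ^ 5 / (1 - p.1 * p.2 ^ 2) ^ 3)
    (fun p => (3 * p.2 ^ 2 + p.1 * p.2 ^ 4) / (1 - p.1 * p.2 ^ 2) ^ 3)
    (fun p => (6 * p.1 * p.2 + 2 * p.1 ^ 2 * p.2 ^ 3) / (1 - p.1 * p.2 ^ 2) ^ 3) where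
  grad p hp := by
    have h := (mixedMap_denom_pos hp).ne'
    refine ((HasGrad.snd p).div (mixedMap_hasGrad_denom p) h).congr ?_ ?_ <;> field_simp <;> ring
  grad_u p hp := by
    have h := (mixedMap_denom_pos hp).ne'
    refine (((HasGrad.snd p).pow 3).div ((mixedMap_hasGrad_denom p).pow 2)
      (pow_ne_zero 2 h)).congr ?_ ?_ <;> norm_num <;> field_simp <;> ring
  grad_v p hp := by
    have h := (mixedMap_denom_pos hp).ne'
    refine (((HasGrad.const 1 p).add ((HasGrad.fst p).mul ((HasGrad.snd p).pow 2))).div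
      ((mixedMap_hasGrad_denom p).pow 2) (pow_ne_zero 2 h)).congr ?_ ?_ <;>
      norm_num <;> field_simp <;> ring

theorem mixedMap_hasPartials_w : HasPartials mixedDomain
    (fun p => -(p.1 ^ 3 * p.2 + 2 * p.1 ^ 4 * p.2 ^ 3 + p.1 ^ 5 * p.2 ^ 5 / 5))
    (fun p => -(3 * p.1 ^ 2 * p.2 + 8 * p.1 ^ 3 * p.2 ^ 3 + p.1 ^ 4 * p.2 ^ 5))
    (fun p => -(p.1 ^ 3 + 6 * p.1 ^ 4 * p.2 ^ 2 + p.1 ^ 5 * p.2 ^ 4))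
    (fun p => -(6 * p.1 * p.2 + 24 * p.1 ^ 2 * p.2 ^ 3 + 4 * p.1 ^ 3 * p.2 ^ 5))
    (fun p => -(3 * p.1 ^ 2 + 24 * p.1 ^ 3 * p.2 ^ 2 + 5 * p.1 ^ 4 * p.2 ^ 4))
    (fun p => -(12 * p.1 ^ 4 * p.2 + 4 * p.1 ^ 5 * p.2 ^ 3)) where
  grad p _ := by
    refine (((((HasGrad.fst p).pow 3).mul (.snd p)).add (((HasGrad.const 2 p).mul
      ((HasGrad.fst p).pow 4)).mul ((HasGrad.snd p).pow 3))).add ((((HasGrad.fst p).pow 5).mul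
      ((HasGrad.snd p).pow 5)).div (.const 5 p) (by norm_num))).neg.congr ?_ ?_ <;>
      norm_num <;> ring
  grad_u p _ := by
    refine (((((HasGrad.const 3 p).mul ((HasGrad.fst p).pow 2)).mul (.snd p)).add
      (((HasGrad.const 8 p).mul ((HasGrad.fst p).pow 3)).mul ((HasGrad.snd p).pow 3))).add
      (((HasGrad.fst p).pow 4).mul ((HasGrad.snd p).pow 5))).neg.congr ?_ ?_ <;> norm_num1 <;> ring
  grad_v p _ := by
    refine ((((HasGrad.fst p).pow 3).add (((HasGrad.const 6 p).mul ((HasGrad.fst p).pow 4)).mul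
      ((HasGrad.snd p).pow 2))).add (((HasGrad.fst p).pow 5).mul
      ((HasGrad.snd p).pow 4))).neg.congr ?_ ?_ <;> norm_num1 <;> ring

theorem isOpen_mixedDomain : IsOpen mixedDomain :=
  isOpen_lt (by fun_prop) continuous_const

theorem isPlaneDomain_mixedDomain : IsPlaneDomain mixedDomain := by
  refine isPlaneDomain_of_starConvex isOpen_mixedDomain (by simp [mixedDomain]) ?_
  rintro p hp t ⟨ht0, ht1⟩
  simp only [mixedDomain, mem_ofPred_eq, Prod.smul_fst, Prod.smul_snd, smul_eq_mul] at hp ⊢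
  have : t * p.1 * (t * p.2) ^ 2 = t ^ 3 * (p.1 * p.2 ^ 2) := by ring
  rw [this, abs_mul, abs_of_nonneg (by positivity)]
  exact (mul_le_of_le_one_left (abs_nonneg _) (pow_le_one₀ ht0 ht1)).trans_lt hp

theorem B_mixedMap {p : ℝ × ℝ} (hp : p ∈ mixedDomain) :
    B mixedMap p = -4 * p.1 ^ 3 * (1 + 3 * p.1 * p.2 ^ 2) ^ 4 / (1 - p.1 * p.2 ^ 2) ^ 4 := by
  refine (B_ofNull (mixedMap_hasPartials_x.grad p hp) (mixedMap_hasPartials_z.grad p hp)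
    (mixedMap_hasPartials_w.grad p hp)).trans ?_
  have h := (mixedMap_denom_pos hp).ne'
  field_simp
  ring

theorem A_mixedMap {p : ℝ × ℝ} (hp : p ∈ mixedDomain) : A mixedMap p = 0 := by
  refine (A_ofNull isOpen_mixedDomain mixedMap_hasPartials_x mixedMap_hasPartials_z
    mixedMap_hasPartials_w hp).trans ?_
  have h := (mixedMap_denom_pos hp).ne'
  field_simp
  ring

/-- The reason for the bound 1/3: the Jacobian of (x, z) vanishes when 1 + 3r = 0. -/
theorem one_add_three_mul_pos_of_mem_mixedDomain {p : ℝ × ℝ} (hp : p ∈ mixedDomain) :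
    0 < 1 + 3 * (p.1 * p.2 ^ 2) := by
  have h : -(1 / 3) < p.1 * p.2 ^ 2 := (abs_lt.1 hp).1
  linarith

theorem injective_fderiv_mixedMap {p : ℝ × ℝ} (hp : p ∈ mixedDomain) :
    Function.Injective (fderiv ℝ mixedMap p) := by
  refine injective_fderiv_ofNull (mixedMap_hasPartials_x.grad p hp)
    (mixedMap_hasPartials_z.grad p hp) (mixedMap_hasPartials_w.grad p hp) ?_
  have h := mixedMap_denom_pos hp
  have h' := one_add_three_mul_pos_of_mem_mixedDomain hp
  have : (1 + 2 * p.1 * p.2 ^ 2) * ((1 + p.1 * p.2 ^ 2) / (1 - p.1 * p.2 ^ 2) ^ 2)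
      - 2 * p.1 ^ 2 * p.2 * (p.2 ^ 3 / (1 - p.1 * p.2 ^ 2) ^ 2)
      = (1 + 3 * (p.1 * p.2 ^ 2)) / (1 - p.1 * p.2 ^ 2) ^ 2 := by
    field_simp
    ring
  rw [this]
  positivity

theorem contDiffOn_mixedMap : ContDiffOn ℝ ∞ mixedMap mixedDomain := by
  refine contDiffOn_ofNull (by fun_prop) (ContDiffOn.div (by fun_prop) (by fun_prop) ?_)
    (by fun_prop)
  exact fun p hp => (mixedMap_denom_pos hp).ne'

/-- A continuous left inverse of `mixedMap`. -/
noncomputable def mixedMapInv (q : R31) : ℝ × ℝ :=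
  (q 0 * (√(1 + 8 * (q 0 * ((q 1 + q 2) / 2) ^ 2)) + 3) /
      (2 * √(1 + 8 * (q 0 * ((q 1 + q 2) / 2) ^ 2)) + 2),
    4 * ((q 1 + q 2) / 2) / (√(1 + 8 * (q 0 * ((q 1 + q 2) / 2) ^ 2)) + 3))

theorem continuous_mixedMapInv : Continuous mixedMapInv := by
  unfold mixedMapInv
  refine Continuous.prodMk (Continuous.div (by fun_prop) (by fun_prop) fun q => ?_)
    (Continuous.div (by fun_prop) (by fun_prop) fun q => ?_) <;> positivity

theorem leftInvOn_mixedMapInv : LeftInvOn mixedMapInv mixedMap mixedDomain := by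
  rintro ⟨u, v⟩ hp
  have h : 0 < 1 - u * v ^ 2 := mixedMap_denom_pos hp
  have h₃ : 0 < 1 + 3 * (u * v ^ 2) := one_add_three_mul_pos_of_mem_mixedDomain hp
  have h₁ : 0 < 1 + u * v ^ 2 := by linarith
  -- With k = xz² = r(1 + r)/(1 - r)², the quadratic for r has discriminant 1 + 8k, a square whose
  -- positive root needs 1 + 3r > 0.
  have hs : √(1 + 8 * ((u + u ^ 2 * v ^ 2) * (v / (1 - u * v ^ 2)) ^ 2))
      = (1 + 3 * (u * v ^ 2)) / (1 - u * v ^ 2) := by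
    rw [Real.sqrt_eq_iff_mul_self_eq_of_pos (by positivity)]
    field_simp
    ring
  have hz : (mixedMap (u, v) 1 + mixedMap (u, v) 2) / 2 = v / (1 - u * v ^ 2) := by
    simp only [mixedMap, ofNull, Matrix.cons_val]
    ring
  have hx : mixedMap (u, v) 0 = u + u ^ 2 * v ^ 2 := rfl
  have ha : (1 + 3 * (u * v ^ 2)) / (1 - u * v ^ 2) + 3 = 4 / (1 - u * v ^ 2) := by
    field_simp
    ring
  have hb : 2 * ((1 + 3 * (u * v ^ 2)) / (1 - u * v ^ 2)) + 2
      = 4 * (1 + u * v ^ 2) / (1 - u * v ^ 2) := by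
    field_simp
    ring
  rw [mixedMapInv, hz, hx, hs, ha, hb]
  ext
  · simp only
    field_simp
  · generalize 1 - u * v ^ 2 = e at h
    simp only
    field_simp

theorem isEmbedded_mixedMap : IsEmbedded mixedDomain mixedMap :=
  ⟨fun _ hp => injective_fderiv_mixedMap hp,
    isEmbedding_of_leftInvOn contDiffOn_mixedMap.continuousOn continuous_mixedMapInv
      leftInvOn_mixedMapInv⟩

theorem isMixedType_mixedMap : IsMixedType mixedDomain mixedMap := by
  have h (u : ℝ) : (u, (0 : ℝ)) ∈ mixedDomain := by simp [mixedDomain]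
  -- On v = 0, B_f = -4u³.
  refine ⟨⟨(-1, 0), h _, ?_⟩, (1, 0), h _, ?_⟩ <;> rw [B_mixedMap (h _)] <;> norm_num

theorem containsEntireNullLine_mixedMap : ContainsEntireNullLine mixedDomain mixedMap := by
  have h (s : ℝ) : ((0 : ℝ), s) ∈ mixedDomain := by simp [mixedDomain]
  refine containsEntireNullLine_of_axis h (fun s => ?_) fun s => ?_
  · simp [B_mixedMap (h s)]
  · simp [mixedMap]

theorem isZMCMap_maxMap : IsZMCMap maxDomain maxMap :=
  .of_immersion isOpen_maxDomain contDiffOn_maxMap (fun _ => injective_fderiv_maxMap)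
    fun _ => A_maxMap

theorem isZMCMap_mixedMap : IsZMCMap mixedDomain mixedMap :=
  .of_immersion isOpen_mixedDomain contDiffOn_mixedMap (fun _ => injective_fderiv_mixedMap)
    fun _ => A_mixedMap

end LorentzMinkowski

theorem mainTheorem1 :
    (∃ (U : Set (ℝ × ℝ)) (f : ℝ × ℝ → LorentzMinkowski.R31),
      LorentzMinkowski.IsPlaneDomain U ∧
      LorentzMinkowski.IsZMCMap U f ∧
      LorentzMinkowski.IsEmbedded U f ∧
      LorentzMinkowski.IsMaximalType U f ∧
      LorentzMinkowski.ContainsEntireNullLine U f) ∧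
    (∃ (U : Set (ℝ × ℝ)) (f : ℝ × ℝ → LorentzMinkowski.R31),
      LorentzMinkowski.IsPlaneDomain U ∧
      LorentzMinkowski.IsZMCMap U f ∧
      LorentzMinkowski.IsEmbedded U f ∧
      LorentzMinkowski.IsMixedType U f ∧
      LorentzMinkowski.ContainsEntireNullLine U f) := by
  exact ⟨⟨LorentzMinkowski.maxDomain, LorentzMinkowski.maxMap, LorentzMinkowski.isPlaneDomain_maxDomain,
      LorentzMinkowski.isZMCMap_maxMap, LorentzMinkowski.isEmbedded_maxMap,
      LorentzMinkowski.isMaximalType_maxMap,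
      LorentzMinkowski.containsEntireNullLine_maxMap⟩,
    ⟨LorentzMinkowski.mixedDomain, LorentzMinkowski.mixedMap, LorentzMinkowski.isPlaneDomain_mixedDomain,
      LorentzMinkowski.isZMCMap_mixedMap, LorentzMinkowski.isEmbedded_mixedMap,
      LorentzMinkowski.isMixedType_mixedMap,
      LorentzMinkowski.containsEntireNullLine_mixedMap⟩⟩
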